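/- Let $k>1$ be an integer that is not a perfect square, and let $x,y,z$ be positive integers with $x^2+(2k-1)^y=k^z$ and $y\in\{3,5\}$. Then $z$ is odd, and there are positive integers $X_1,Y_1,Z_1,t$, a sign $\lambda\in\{1,-1\}$ and integers $u,v$ with $u^2-kv^2=1$ such that $$y=Z_1t,\qquad x+k^{(z-1)/2}\sqrt{k}=(X_1+\lambda Y_1\sqrt{k})^t(u+v\sqrt{k}),$$ $$X_1^2-kY_1^2=(-(2k-1))^{Z_1},\qquad \gcd(X_1,Y_1)=1,\qquad Z_1\mid h(4k),$$ $$1<\left|\frac{X_1+Y_1\sqrt{k}}{X_1-Y_1\sqrt{k}}\right|<u_1+v_1\sqrt{k}.$$ Here $h(4k)$ is the class number of primitive binary quadratic forms of discriminant $4k$, that is, the number of $\mathrm{SL}_2(\mathbb{Z})$-equivalence classes of forms $aX^2+bXY+cY^2$ with $a,b,c\in\mathbb{Z}$, $\gcd(a,b,c)=1$ and $b^2-4ac=4k$; and $(u_1,v_1)$ is the least solution of Pell's equation $u^2-kv^2=1$, that is, the solution in positive integers for which $u_1+v_1\sqrt{k}$ is smallest. -/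

import Mathlib

/-- The integral binary quadratic form `a X² + b X Y + c Y²`. -/
@[ext]
structure BinaryForm where
  a : ℤ
  b : ℤ
  c : ℤ

namespace BinaryForm

/-- The value of a form at `(X, Y)`. -/
def eval (f : BinaryForm) (X Y : ℤ) : ℤ :=
  f.a * X ^ 2 + f.b * X * Y + f.c * Y ^ 2

/-- The discriminant `b² - 4ac`. -/
def discr (f : BinaryForm) : ℤ :=
  f.b ^ 2 - 4 * f.a * f.c

/-- A form is primitive if its three coefficients have no common factor. -/
def IsPrimitive (f : BinaryForm) : Prop :=
  Int.gcd (Int.gcd f.a f.b) f.c = 1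

/-- Proper equivalence: `g` arises from `f` by an integral substitution of determinant `1`. -/
def ProperEquiv (f g : BinaryForm) : Prop :=
  ∃ p q r s : ℤ, p * s - q * r = 1 ∧
    ∀ X Y : ℤ, g.eval X Y = f.eval (p * X + q * Y) (r * X + s * Y)

theorem ProperEquiv.refl (f : BinaryForm) : ProperEquiv f f :=
  ⟨1, 0, 0, 1, by norm_num, fun X Y => by simp⟩

theorem ProperEquiv.symm {f g : BinaryForm} (h : ProperEquiv f g) : ProperEquiv g f := by
  obtain ⟨p, q, r, s, hd, h⟩ := h
  refine ⟨s, -q, -r, p, by linarith, fun X Y => ?_⟩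
  rw [h]
  congr 1
  · linear_combination (-X) * hd
  · linear_combination (-Y) * hd

theorem ProperEquiv.trans {f g e : BinaryForm} (h : ProperEquiv f g) (h' : ProperEquiv g e) :
    ProperEquiv f e := by
  obtain ⟨p, q, r, s, hd, h⟩ := h
  obtain ⟨p', q', r', s', hd', h'⟩ := h'
  refine ⟨p * p' + q * r', p * q' + q * s', r * p' + s * r', r * q' + s * s', ?_, fun X Y => ?_⟩
  · linear_combination (p' * s' - q' * r') * hd + hd'
  · rw [h', h]
    congr 1 <;> ring

/-- Proper equivalence on the primitive forms of discriminant `D`. -/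
def properSetoid (D : ℤ) : Setoid {f : BinaryForm // f.discr = D ∧ f.IsPrimitive} where
  r f g := ProperEquiv f.1 g.1
  iseqv := ⟨fun f => ProperEquiv.refl f.1, fun h => h.symm, fun h h' => h.trans h'⟩

/-- The class number `h(D)` for a nonsquare discriminant `D > 0`: the (finite) number of proper
equivalence classes of primitive integral binary quadratic forms of discriminant `D`. -/
noncomputable def classNumber (D : ℤ) : ℕ :=
  Nat.card (Quotient (properSetoid D))

end BinaryForm

/-- `(u, v)` is the least solution of Pell's equation `u² - k v² = 1`: the solution in positive
integers for which the real number `u + v √k` is smallest. -/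
def IsLeastPellSolution (k : ℕ) (u v : ℤ) : Prop :=
  0 < u ∧ 0 < v ∧ u ^ 2 - k * v ^ 2 = 1 ∧
    ∀ U V : ℤ, 0 < U → 0 < V → U ^ 2 - k * V ^ 2 = 1 →
      (u : ℝ) + v * Real.sqrt k ≤ U + V * Real.sqrt k

/-! If `z = 2m`, then `(2k-1)^y` is a difference of two squares, the larger being `(k^m)^2`. Size
leaves few values of `m`; for large `k` the number `k^(2m) - (2k-1)^y` lies strictly between
consecutive squares, and for small `k` it is negative or a nonresidue modulo a small prime. So `z`
is odd.

Now put `N = -(2k-1)` and `α = x + k^((z-1)/2)√k`, so `α` has norm `N^y`. The ideal `L = (N, α)`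
satisfies `L·L̄ = (N)` and `L^y = (α)`, because `N` is coprime to `2x`. Multiplication by `L`, with
the sign of `N` kept as an orientation, acts on the classes of primitive forms of discriminant `4k`,
and its `y`-th iterate is the identity. Since `y` is prime, either some class is fixed, so that `L =
(δ)` with `δ` of norm `N` and `α = δ^y η` (`Z₁ = 1`, `t = y`), or the action has no fixed point and
`y ∣ h(4k)` (`Z₁ = y`, `t = 1`, `δ = α`). This is `exists_generator_or_dvd_classNumber`.

Finally a power of the least Pell unit moves the ratio of `δ` to its conjugate into the required
window (`exists_reduced_solution`). -/

open Zsqrtd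

/-! ### Oddness of `z`: residues for small `k`, consecutive squares for large `k`. -/

/-- Some prime `p < 60` shows by Euler's criterion that `A - B` is not a square. -/
def differenceNonresidue (A B : ℕ) : Bool :=
  [3, 5, 7, 11, 13, 17, 19, 23, 29, 31, 37, 41, 43, 47, 53, 59].any fun p =>
    ((A + (p - 1) * B) % p) ^ ((p - 1) / 2) % p == p - 1

/-- The term `(p - 1) * B` plays the role of `-B` modulo `p`, avoiding truncated subtraction. The
power is then `x^(p-1)`, which is `0` or `1` modulo `p`. -/
theorem sq_pow_half_mod_ne {p : ℕ} (hp : p.Prime) (h2 : 2 < p) {x A B : ℕ} (h : x ^ 2 + B = A) :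
    ((A + (p - 1) * B) % p) ^ ((p - 1) / 2) % p ≠ p - 1 := by
  intro hc
  have : Fact p.Prime := ⟨hp⟩
  have h1 : (A + (p - 1) * B) = x ^ 2 + p * B := by
    obtain ⟨q, rfl⟩ : ∃ q, p = q + 1 := ⟨p - 1, by omega⟩
    rw [← h, Nat.add_sub_cancel]; ring
  rw [← Nat.pow_mod, h1, Nat.pow_mod, Nat.add_mul_mod_self_left, ← Nat.pow_mod, ← pow_mul,
    Nat.mul_div_cancel' (by
      have := hp.eq_two_or_odd; omega)] at hc
  by_cases hx : p ∣ x
  · have := Nat.mod_eq_zero_of_dvd (dvd_pow hx (show p - 1 ≠ 0 by omega))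
    omega
  · have hx' : (x : ZMod p) ≠ 0 := by rwa [Ne, ZMod.natCast_eq_zero_iff]
    have h3 := ZMod.pow_card_sub_one_eq_one hx'
    have h4 : x ^ (p - 1) ≡ 1 [MOD p] := by
      rw [← ZMod.natCast_eq_natCast_iff]; push_cast; exact h3
    unfold Nat.ModEq at h4
    rw [Nat.mod_eq_of_lt (show 1 < p by omega)] at h4
    omega

theorem add_ne_of_differenceNonresidue {A B x : ℕ} (h : differenceNonresidue A B = true) :
    x ^ 2 + B ≠ A := by
  intro hx
  unfold differenceNonresidue at h
  rw [List.any_eq_true] at h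
  obtain ⟨p, hp, h⟩ := h
  have hpp : p.Prime ∧ 2 < p := by
    simp only [List.mem_cons, List.not_mem_nil, or_false] at hp
    rcases hp with rfl | rfl | rfl | rfl | rfl | rfl | rfl | rfl | rfl | rfl | rfl | rfl | rfl |
      rfl | rfl | rfl <;> norm_num
  exact sq_pow_half_mod_ne hpp.1 hpp.2 hx (by simpa using h)

theorem nonresidue_cube_small : ∀ k < 60, k < 2 ∨ ∀ m < 4, k ^ (2 * m) < (2 * k - 1) ^ 3 ∨
    differenceNonresidue (k ^ (2 * m)) ((2 * k - 1) ^ 3) = true := by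
  decide +kernel

theorem nonresidue_fifth_small : ∀ k < 200, k < 2 ∨ ∀ m < 6, m = 3 ∨
    k ^ (2 * m) < (2 * k - 1) ^ 5 ∨
    differenceNonresidue (k ^ (2 * m)) ((2 * k - 1) ^ 5) = true := by
  decide +kernel

theorem nonresidue_fifth_six : ∀ k < 17, k < 2 ∨
    differenceNonresidue (k ^ (2 * 6)) ((2 * k - 1) ^ 5) = true ∨ (2 * k - 1) ^ 5 + 1 < 2 * k ^ 6 := by
  decide +kernel

/-- The range `k = 165 i + j < 27225` reaches past the threshold `27100` of `fifth_three`. -/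
theorem nonresidue_fifth_three : ∀ i < 165, ∀ j < 165, 165 * i + j < 2 ∨
    (165 * i + j) ^ 6 < (2 * (165 * i + j) - 1) ^ 5 ∨
    differenceNonresidue ((165 * i + j) ^ 6) ((2 * (165 * i + j) - 1) ^ 5) = true := by
  decide +kernel

/-- No integer square lies strictly between two consecutive squares. -/
theorem not_between_consecutive_squares {x P : ℤ} (h1 : (P - 1) ^ 2 < x ^ 2) (h2 : x ^ 2 < P ^ 2)
    (hP : 1 ≤ P) : False := by
  have h3 := sq_lt_sq.1 h1
  have h4 := sq_lt_sq.1 h2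
  rw [abs_of_nonneg (sub_nonneg.2 hP)] at h3
  rw [abs_of_nonneg (show 0 ≤ P by linarith [hP])] at h4
  omega

/-- Here and in the next four lemmas, `P` or `P - 1` is the polynomial part of the square root of
`k^(2m) - (2k-1)^y`, according to the sign of the remainder. -/
theorem cube_two {k x : ℤ} (hk : 16 ≤ k) (h : x ^ 2 + (2 * k - 1) ^ 3 = (k ^ 2) ^ 2) : False :=
  not_between_consecutive_squares (x := x) (P := k ^ 2 - 4 * k - 2) (by nlinarith) (by nlinarith)
    (by nlinarith)

theorem cube_three {k x : ℤ} (hk : 16 ≤ k) (h : x ^ 2 + (2 * k - 1) ^ 3 = (k ^ 3) ^ 2) : False := by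
  obtain ⟨j, rfl⟩ : ∃ j, k = j + 16 := ⟨k - 16, by ring⟩
  have hj : 0 ≤ j := by linarith
  have hx : x ^ 2 = ((j + 16) ^ 3) ^ 2 - (2 * (j + 16) - 1) ^ 3 := by linarith
  refine not_between_consecutive_squares (x := x) (P := (j + 16) ^ 3 - 3) ?_ ?_ ?_
  · rw [hx, ← sub_pos]; ring_nf; positivity
  · rw [hx, ← sub_pos]; ring_nf; positivity
  · rw [← sub_nonneg]; ring_nf; positivity

/-- The remainder after `P^2` is about `-54040 k^2`, while consecutive squares are about `2k^3`
apart; hence the large threshold. -/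
theorem fifth_three {k x : ℤ} (hk : 27100 ≤ k) (h : x ^ 2 + (2 * k - 1) ^ 5 = (k ^ 3) ^ 2) :
    False := by
  obtain ⟨j, rfl⟩ : ∃ j, k = j + 27100 := ⟨k - 27100, by ring⟩
  have hj : 0 ≤ j := by linarith
  have hx : x ^ 2 = ((j + 27100) ^ 3) ^ 2 - (2 * (j + 27100) - 1) ^ 5 := by linarith
  refine not_between_consecutive_squares (x := x)
    (P := (j + 27100) ^ 3 - 16 * (j + 27100) ^ 2 - 88 * (j + 27100) - 1448) ?_ ?_ ?_
  · rw [hx, ← sub_pos]; ring_nf; positivity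
  · rw [hx, ← sub_pos]; ring_nf; positivity
  · rw [← sub_nonneg]; ring_nf; positivity

theorem fifth_four {k x : ℤ} (hk : 100 ≤ k) (h : x ^ 2 + (2 * k - 1) ^ 5 = (k ^ 4) ^ 2) :
    False := by
  obtain ⟨j, rfl⟩ : ∃ j, k = j + 100 := ⟨k - 100, by ring⟩
  have hj : 0 ≤ j := by linarith
  have hx : x ^ 2 = ((j + 100) ^ 4) ^ 2 - (2 * (j + 100) - 1) ^ 5 := by linarith
  refine not_between_consecutive_squares (x := x)
    (P := (j + 100) ^ 4 - 16 * (j + 100) + 40) ?_ ?_ ?_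
  · rw [hx, ← sub_pos]; ring_nf; positivity
  · rw [hx, ← sub_pos]; ring_nf; positivity
  · rw [← sub_nonneg]; ring_nf; positivity

theorem fifth_five {k x : ℤ} (hk : 100 ≤ k) (h : x ^ 2 + (2 * k - 1) ^ 5 = (k ^ 5) ^ 2) :
    False := by
  obtain ⟨j, rfl⟩ : ∃ j, k = j + 100 := ⟨k - 100, by ring⟩
  have hj : 0 ≤ j := by linarith
  have hx : x ^ 2 = ((j + 100) ^ 5) ^ 2 - (2 * (j + 100) - 1) ^ 5 := by linarith
  refine not_between_consecutive_squares (x := x) (P := (j + 100) ^ 5 - 15) ?_ ?_ ?_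
  · rw [hx, ← sub_pos]; ring_nf; positivity
  · rw [hx, ← sub_pos]; ring_nf; positivity
  · rw [← sub_nonneg]; ring_nf; positivity

/-- From `x ≤ K - 1` one gets `N ≥ K^2 - (K-1)^2`. This bounds the exponent `m` when `K = k^m`. -/
theorem two_mul_le_of_sq_add {x N K : ℕ} (hN : 0 < N) (h : x ^ 2 + N = K ^ 2) : 2 * K ≤ N + 1 := by
  have h1 : x < K := lt_of_pow_lt_pow_left₀ 2 (Nat.zero_le K) (by omega)
  nlinarith

theorem sq_add_cube_ne {k x m : ℕ} (hk : 1 < k) : x ^ 2 + (2 * k - 1) ^ 3 ≠ (k ^ m) ^ 2 := by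
  intro h
  have hn : 0 < (2 * k - 1) ^ 3 := pow_pos (by omega) 3
  have hg := two_mul_le_of_sq_add hn h
  have hm : m < 4 := by
    by_contra! hm
    have h1 : k ^ 4 ≤ k ^ m := Nat.pow_le_pow_right (by omega) hm
    obtain ⟨j, rfl⟩ : ∃ j, k = j + 2 := ⟨k - 2, by omega⟩
    rw [show 2 * (j + 2) - 1 = 2 * j + 3 by omega] at hg
    have h2 : (2 * j + 3) ^ 3 + 1 < 2 * (j + 2) ^ 4 := by ring_nf; omega
    omega
  by_cases h60 : k < 60
  · rcases nonresidue_cube_small k h60 with h1 | h1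
    · omega
    · rcases h1 m hm with h1 | h1
      · rw [mul_comm 2 m, pow_mul] at h1; omega
      · rw [mul_comm 2 m, pow_mul] at h1
        exact add_ne_of_differenceNonresidue h1 h
  · have hz : (x : ℤ) ^ 2 + (2 * (k : ℤ) - 1) ^ 3 = ((k : ℤ) ^ m) ^ 2 := by
      have := congrArg (Nat.cast : ℕ → ℤ) h
      rw [Nat.cast_add, Nat.cast_pow (2 * k - 1), Nat.cast_sub (by omega)] at this
      push_cast at this; exact this
    have hlow : 2 ≤ m := by
      by_contra! hm
      have h1 : (k ^ m) ^ 2 ≤ k ^ 3 := by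
        rw [← pow_mul]; exact Nat.pow_le_pow_right (by omega) (by omega)
      have h2 : k ^ 3 < (2 * k - 1) ^ 3 := Nat.pow_lt_pow_left (by omega) (by omega)
      omega
    have hk16 : (16 : ℤ) ≤ k := by omega
    obtain rfl | rfl : m = 2 ∨ m = 3 := by omega
    · exact cube_two hk16 hz
    · exact cube_three hk16 hz

theorem sq_add_fifth_ne {k x m : ℕ} (hk : 1 < k) : x ^ 2 + (2 * k - 1) ^ 5 ≠ (k ^ m) ^ 2 := by
  intro h
  have hn : 0 < (2 * k - 1) ^ 5 := pow_pos (by omega) 5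
  have hg := two_mul_le_of_sq_add hn h
  have hm : m < 7 := by
    by_contra! hm
    have h1 : k ^ 7 ≤ k ^ m := Nat.pow_le_pow_right (by omega) hm
    obtain ⟨j, rfl⟩ : ∃ j, k = j + 2 := ⟨k - 2, by omega⟩
    rw [show 2 * (j + 2) - 1 = 2 * j + 3 by omega] at hg
    have h2 : (2 * j + 3) ^ 5 + 1 < 2 * (j + 2) ^ 7 := by ring_nf; omega
    omega
  have hlow : 3 ≤ m := by
    by_contra! hm
    have h1 : (k ^ m) ^ 2 ≤ k ^ 5 := by
      rw [← pow_mul]; exact Nat.pow_le_pow_right (by omega) (by omega)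
    have h2 : k ^ 5 < (2 * k - 1) ^ 5 := Nat.pow_lt_pow_left (by omega) (by omega)
    omega
  have hz : (x : ℤ) ^ 2 + (2 * (k : ℤ) - 1) ^ 5 = ((k : ℤ) ^ m) ^ 2 := by
    have := congrArg (Nat.cast : ℕ → ℤ) h
    rw [Nat.cast_add, Nat.cast_pow (2 * k - 1), Nat.cast_sub (by omega)] at this
    push_cast at this; exact this
  obtain rfl | rfl | hm' : m = 6 ∨ m = 3 ∨ (m = 4 ∨ m = 5) := by omega
  -- For `k ≥ 17`, `2k^6 ≥ 34k^5` already exceeds `(2k-1)^5 + 1`, against `hg`.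
  · by_cases hk16 : k < 17
    · rcases nonresidue_fifth_six k hk16 with h1 | h1 | h1
      · omega
      · rw [mul_comm, pow_mul] at h1
        exact add_ne_of_differenceNonresidue h1 h
      · omega
    · have h1 : (2 * k - 1) ^ 5 < (2 * k) ^ 5 := Nat.pow_lt_pow_left (by omega) (by omega)
      have h2 : 17 * k ^ 5 ≤ k * k ^ 5 := Nat.mul_le_mul_right _ (by omega)
      have h3 : k * k ^ 5 = k ^ 6 := by ring
      have h4 : 0 < k ^ 5 := pow_pos (by omega) 5
      rw [mul_pow] at h1
      omega
  · by_cases hk1 : k < 165 * 165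
    · have h0 := nonresidue_fifth_three (k / 165) (by omega) (k % 165) (by omega)
      rw [Nat.div_add_mod, show k ^ 6 = (k ^ 3) ^ 2 by ring] at h0
      rcases h0 with h1 | h1 | h1
      · omega
      · omega
      · exact add_ne_of_differenceNonresidue h1 h
    · exact fifth_three (by omega) hz
  · by_cases hk1 : k < 200
    · rcases nonresidue_fifth_small k hk1 with h1 | h1
      · omega
      · have h2 := h1 m (by omega)
        rw [mul_comm 2 m, pow_mul] at h2
        rcases h2 with h2 | h2 | h2
        · omega
        · omega
        · exact add_ne_of_differenceNonresidue h2 h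
    · obtain rfl | rfl := hm'
      · exact fifth_four (by omega) hz
      · exact fifth_five (by omega) hz

theorem odd_exponent {k x y z : ℕ} (hk : 1 < k) (hy : y = 3 ∨ y = 5)
    (h : (x : ℤ) ^ 2 + (2 * (k : ℤ) - 1) ^ y = (k : ℤ) ^ z) : Odd z := by
  by_contra hz
  obtain ⟨m, rfl⟩ := Nat.not_odd_iff_even.1 hz
  have h' : x ^ 2 + (2 * k - 1) ^ y = (k ^ m) ^ 2 := by
    zify
    rw [Nat.cast_sub (by omega)]
    push_cast
    rw [h]; ring
  rcases hy with rfl | rfl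
  · exact sq_add_cube_ne hk h'
  · exact sq_add_fifth_ne hk h'

/-! ### Forms of discriminant `4k` and oriented ideal classes of `ℤ[√k]`. -/

namespace BinaryForm

/-- The root `b / 2 + √k` attached to a form of discriminant `4k`. -/
def root (k : ℕ) (f : BinaryForm) : ℤ√(k : ℤ) := ⟨f.b / 2, 1⟩

/-- The ideal `(a, b / 2 + √k)` attached to a form of discriminant `4k`. -/
def toIdeal (k : ℕ) (f : BinaryForm) : Ideal (ℤ√(k : ℤ)) :=
  Ideal.span {(f.a : ℤ√(k : ℤ)), f.root k}

theorem two_mul_half_b {k : ℕ} {f : BinaryForm} (hd : f.discr = 4 * k) :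
    f.b = 2 * (f.b / 2) := by
  unfold discr at hd
  have h : (2 : ℤ) ∣ f.b ^ 2 := ⟨2 * k + 2 * (f.a * f.c), by linarith⟩
  have := Int.prime_two.dvd_of_dvd_pow h
  omega

theorem half_b_sq {k : ℕ} {f : BinaryForm} (hd : f.discr = 4 * k) :
    (f.b / 2) ^ 2 = k + f.a * f.c := by
  have h := two_mul_half_b hd
  unfold discr at hd
  rw [h] at hd
  linarith

theorem a_ne_zero {k : ℕ} (hk : ¬ IsSquare k) {f : BinaryForm} (hd : f.discr = 4 * k) :
    f.a ≠ 0 := by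
  intro ha
  have h := half_b_sq hd
  rw [ha, zero_mul, add_zero] at h
  apply hk
  refine ⟨(f.b / 2).natAbs, ?_⟩
  zify
  rw [← sq, sq_abs, h]

theorem norm_root {k : ℕ} {f : BinaryForm} (hd : f.discr = 4 * k) :
    (f.root k).norm = f.a * f.c := by
  have := half_b_sq hd
  simp only [root, norm_def]
  linarith

theorem mem_toIdeal {k : ℕ} {f : BinaryForm} (hd : f.discr = 4 * k) {w : ℤ√(k : ℤ)} :
    w ∈ f.toIdeal k ↔ ∃ X Y : ℤ, w = f.a * X + f.root k * Y := by
  have h := half_b_sq hd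
  rw [toIdeal, Ideal.mem_span_pair]
  constructor
  · rintro ⟨s, t, rfl⟩
    refine ⟨s.re - f.b / 2 * s.im - f.c * t.im, t.re + f.a * s.im + f.b / 2 * t.im, ?_⟩
    ext
    · simp [root]
      linear_combination (-t.im) * h
    · simp [root]
      ring
  · rintro ⟨X, Y, rfl⟩
    exact ⟨X, Y, by ring⟩

theorem norm_combination {k : ℕ} {f : BinaryForm} (hd : f.discr = 4 * k) (X Y : ℤ) :
    ((f.a : ℤ√(k : ℤ)) * X + f.root k * Y).norm = f.a * f.eval X Y := by
  have h := half_b_sq hd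
  have h2 := two_mul_half_b hd
  simp [norm_def, root, eval]
  linear_combination Y ^ 2 * h - f.a * X * Y * h2

/-- The `√k`-coefficient of `v̄w` is an oriented area on the lattice, so it detects the determinant
of a change of basis with its sign. -/
theorem star_combination_mul {k : ℕ} (f : BinaryForm) (p q r s : ℤ) :
    (star ((f.a : ℤ√(k : ℤ)) * p + f.root k * r) * (f.a * q + f.root k * s)).im =
      f.a * (p * s - q * r) := by
  simp [root]
  ring

/-- `g` lies in the class of `L · f`, where the sign of `N` records the orientation of `L`. -/
def Linked (k : ℕ) (L : Ideal (ℤ√(k : ℤ))) (N : ℤ) (f g : BinaryForm) : Prop :=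
  ∃ β γ : ℤ√(k : ℤ), β ≠ 0 ∧ γ ≠ 0 ∧
    Ideal.span {β} * g.toIdeal k = Ideal.span {γ} * L * f.toIdeal k ∧
    β.norm * g.a = N * γ.norm * f.a

theorem Linked.mul {k : ℕ} [Zsqrtd.Nonsquare k] {L L' : Ideal (ℤ√(k : ℤ))} {N N' : ℤ}
    {f g e : BinaryForm} (h : Linked k L N f g) (h' : Linked k L' N' g e) :
    Linked k (L * L') (N * N') f e := by
  obtain ⟨β, γ, hβ, hγ, hI, hN⟩ := h
  obtain ⟨β', γ', hβ', hγ', hI', hN'⟩ := h'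
  refine ⟨β * β', γ * γ', mul_ne_zero hβ hβ', mul_ne_zero hγ hγ', ?_, ?_⟩
  · rw [← Ideal.span_singleton_mul_span_singleton, ← Ideal.span_singleton_mul_span_singleton,
      mul_assoc, hI']
    calc _ = Ideal.span {γ'} * L' * (Ideal.span {β} * g.toIdeal k) := by ring
      _ = _ := by rw [hI]; ring
  · rw [norm_mul, norm_mul]
    linear_combination N' * γ'.norm * hN + β.norm * hN'

/-- Multiplication by `β/δ` carries the lattice of `g` into that of `f`. Expressing the image of the
basis of `g` in the basis of `f` gives the substitution; norms match the values of the forms. -/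
theorem Linked.properEquiv {k : ℕ} (hk : ¬ IsSquare k) {α : ℤ√(k : ℤ)} {f g : BinaryForm}
    (hf : f.discr = 4 * k) (hg : g.discr = 4 * k)
    (h : Linked k (Ideal.span {α}) α.norm f g) : ProperEquiv f g := by
  obtain ⟨β, γ, hβ, hγ, hI, hN⟩ := h
  rw [Ideal.span_singleton_mul_span_singleton] at hI
  rw [mul_comm α.norm, ← norm_mul] at hN
  set δ := γ * α
  have key : ∀ w ∈ g.toIdeal k, ∃ v ∈ f.toIdeal k, δ * v = β * w := by
    intro w hw
    have : β * w ∈ Ideal.span {β} * g.toIdeal k :=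
      Ideal.mul_mem_mul (Ideal.mem_span_singleton_self β) hw
    rw [hI, Ideal.mem_span_singleton_mul] at this
    exact this
  obtain ⟨v, hv, hv'⟩ := key g.a (Ideal.subset_span (by simp))
  obtain ⟨w, hw, hw'⟩ := key (g.root k) (Ideal.subset_span (by simp))
  obtain ⟨p, r, rfl⟩ := (mem_toIdeal hf).1 hv
  obtain ⟨q, s, rfl⟩ := (mem_toIdeal hf).1 hw
  have hβN : β.norm ≠ 0 := fun h0 => hβ ((norm_eq_zero (fun n hn => hk
    ⟨n.natAbs, by zify; rw [hn, ← sq, ← sq, sq_abs]⟩) β).1 h0)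
  have hne : β.norm * g.a ≠ 0 := mul_ne_zero hβN (a_ne_zero hk hg)
  refine ⟨p, q, r, s, ?_, fun X Y => ?_⟩
  -- Comparing oriented areas, the norm condition in `Linked` forces determinant `1` rather than
  -- `-1`.
  · have h1 : star (δ * (f.a * p + f.root k * r)) * (δ * (f.a * q + f.root k * s)) =
        star (β * g.a) * (β * g.root k) := by rw [hv', hw']
    have h2 : ∀ a b c : ℤ√(k : ℤ), star (a * b) * (a * c) = (a.norm : ℤ√(k : ℤ)) * (star b * c) := by
      intro a b c
      rw [norm_eq_mul_conj, star_mul]; ring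
    rw [h2, h2] at h1
    have h3 := congrArg Zsqrtd.im h1
    rw [im_smul, im_smul, star_combination_mul] at h3
    have h4 : (star (g.a : ℤ√(k : ℤ)) * g.root k).im = g.a := by simp [root]
    rw [h4] at h3
    apply mul_left_cancel₀ hne
    linear_combination h3 + (p * s - q * r) * hN
  · have h1 : δ * (f.a * (p * X + q * Y : ℤ) + f.root k * (r * X + s * Y : ℤ)) =
        β * (g.a * X + g.root k * Y) := by
      push_cast
      linear_combination (X : ℤ√(k : ℤ)) * hv' + (Y : ℤ√(k : ℤ)) * hw'
    have h2 := congrArg Zsqrtd.norm h1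
    rw [norm_mul δ, norm_mul β, norm_combination hf, norm_combination hg] at h2
    apply mul_left_cancel₀ hne
    linear_combination -h2 - f.eval (p * X + q * Y) (r * X + s * Y) * hN

theorem ProperEquiv.coeffs {f g : BinaryForm} (h : ProperEquiv f g) :
    ∃ p q r s : ℤ, p * s - q * r = 1 ∧ g.a = f.eval p r ∧
      g.b = 2 * f.a * p * q + f.b * (p * s + q * r) + 2 * f.c * r * s ∧ g.c = f.eval q s := by
  obtain ⟨p, q, r, s, hd, h⟩ := h
  have ha : g.a = f.eval p r := by have := h 1 0; simp [eval] at this ⊢; linarith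
  have hc : g.c = f.eval q s := by have := h 0 1; simp [eval] at this ⊢; linarith
  refine ⟨p, q, r, s, hd, ha, ?_, hc⟩
  have := h 1 1; simp [eval] at this ha hc; linarith

/-- With `ω = f.a p + θ r`, where `θ` is the root of `f`, one has `ω I_g = (g.a) I_f` and `N(ω) =
f.a g.a`. -/
theorem ProperEquiv.linked {k : ℕ} (hk : ¬ IsSquare k) {f g : BinaryForm}
    (hf : f.discr = 4 * k) (hg : g.discr = 4 * k) (h : ProperEquiv f g) : Linked k 1 1 f g := by
  obtain ⟨p, q, r, s, hd, ha, hb, -⟩ := h.coeffs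
  have hf2 := two_mul_half_b hf
  have hg2 := two_mul_half_b hg
  have hfk := half_b_sq hf
  have hb' : g.b / 2 = f.a * p * q + f.b / 2 * (p * s + q * r) + f.c * r * s := by
    rw [hf2] at hb; linarith
  set ω : ℤ√(k : ℤ) := f.a * p + f.root k * r with hω
  have hωθ : ω * g.root k = g.a * (f.a * q + f.root k * s) := by
    ext
    · simp only [hω, root, hb', ha, eval, re_mul, im_mul, re_add, im_add, re_intCast, im_intCast]
      rw [hf2]
      generalize f.b / 2 = t at *
      rw [show 2 * t / 2 = t by omega]
      linear_combination (-r) * hfk - r * (t ^ 2 - f.a * f.c) * hd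
    · simp only [hω, root, hb', ha, eval, re_mul, im_mul, re_add, im_add, re_intCast, im_intCast]
      rw [hf2]
      generalize f.b / 2 = t at *
      rw [show 2 * t / 2 = t by omega]
      linear_combination -(f.a * p + t * r) * hd
  have hNω : ω.norm = f.a * g.a := by rw [norm_combination hf, ha]
  have hω0 : ω ≠ 0 := by
    rintro h0
    rw [h0, Zsqrtd.norm_zero] at hNω
    exact mul_ne_zero (a_ne_zero hk hf) (a_ne_zero hk hg) hNω.symm
  have hd' : (p * s - q * r : ℤ√(k : ℤ)) = 1 := by exact_mod_cast congrArg (Int.cast : ℤ → ℤ√(k : ℤ)) hd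
  refine ⟨ω, g.a, hω0, by exact_mod_cast a_ne_zero hk hg, ?_, ?_⟩
  · rw [mul_one]
    apply _root_.le_antisymm
    · rw [Ideal.span_singleton_mul_le_iff]
      intro w hw
      obtain ⟨X, Y, rfl⟩ := (mem_toIdeal hg).1 hw
      rw [Ideal.mem_span_singleton_mul]
      refine ⟨f.a * (p * X + q * Y : ℤ) + f.root k * (r * X + s * Y : ℤ),
        (mem_toIdeal hf).2 ⟨_, _, rfl⟩, ?_⟩
      push_cast
      linear_combination -(Y : ℤ√(k : ℤ)) * hωθ - g.a * X * hω
    · rw [Ideal.span_singleton_mul_le_iff]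
      intro w hw
      obtain ⟨X, Y, rfl⟩ := (mem_toIdeal hf).1 hw
      rw [Ideal.mem_span_singleton_mul]
      refine ⟨g.a * (s * X - q * Y : ℤ) + g.root k * (p * Y - r * X : ℤ),
        (mem_toIdeal hg).2 ⟨_, _, rfl⟩, ?_⟩
      push_cast
      linear_combination (p * Y - r * X : ℤ√(k : ℤ)) * hωθ + g.a * (s * X - q * Y : ℤ√(k : ℤ)) * hω
        + g.a * (f.a * X + f.root k * Y) * hd'
  · rw [norm_intCast, hNω]; ring

end BinaryForm

/-! ### Ideals as multiples of form ideals, and multiplication of classes by an invertible ideal. -/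

theorem Zsqrtd.norm_ne_zero {k : ℕ} [Zsqrtd.Nonsquare k] {w : ℤ√(k : ℤ)} (hw : w ≠ 0) :
    w.norm ≠ 0 := by
  intro h
  have h1 := norm_eq_mul_conj w
  rw [h, Int.cast_zero, eq_comm, mul_eq_zero, star_eq_zero] at h1
  exact hw (h1.elim id id)

theorem Ideal.mem_left_of_mem_mul {R : Type*} [CommRing R] {I J : Ideal R} {r : R}
    (h : r ∈ I * J) : r ∈ I :=
  Ideal.mul_le_left h

namespace BinaryForm

/-- Hermite normal form: `g` generates the `√k`-coefficients of `J` and `m` generates `J ∩ ℤ`.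
Multiplying by `√k` shows that `g` divides everything. -/
theorem exists_span_mul_toIdeal {k : ℕ} [Zsqrtd.Nonsquare k] {J : Ideal (ℤ√(k : ℤ))}
    (hJ : J ≠ ⊥) : ∃ (g : ℤ) (f : BinaryForm), g ≠ 0 ∧ f.discr = 4 * k ∧
      J = Ideal.span {(g : ℤ√(k : ℤ))} * f.toIdeal k := by
  let A : Ideal ℤ :=
    { carrier := {y | ∃ x, (⟨x, y⟩ : ℤ√(k : ℤ)) ∈ J}
      add_mem' := by
        rintro y y' ⟨x, hx⟩ ⟨x', hx'⟩
        exact ⟨x + x', by simpa [Zsqrtd.add_def] using J.add_mem hx hx'⟩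
      zero_mem' := ⟨0, J.zero_mem⟩
      smul_mem' := by
        rintro c y ⟨x, hx⟩
        exact ⟨c * x, by simpa [Zsqrtd.smul_val] using J.mul_mem_left (c : ℤ√(k : ℤ)) hx⟩ }
  let B : Ideal ℤ := J.comap (Int.castRingHom _)
  obtain ⟨g, hg⟩ := (inferInstance : A.IsPrincipal).principal
  obtain ⟨m, hm⟩ := (inferInstance : B.IsPrincipal).principal
  have hA : ∀ {w : ℤ√(k : ℤ)}, w ∈ J → g ∣ w.im := by
    intro w hw
    have : w.im ∈ A := ⟨w.re, hw⟩
    rwa [hg, Ideal.submodule_span_eq, Ideal.mem_span_singleton] at this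
  have hB : ∀ {n : ℤ}, (n : ℤ√(k : ℤ)) ∈ J → m ∣ n := by
    intro n hn
    have : n ∈ B := hn
    rwa [hm, Ideal.submodule_span_eq, Ideal.mem_span_singleton] at this
  have hmJ : (m : ℤ√(k : ℤ)) ∈ J := by
    have : m ∈ B := by rw [hm]; exact Ideal.mem_span_singleton_self m
    exact this
  obtain ⟨x₀, hx₀⟩ : g ∈ A := by rw [hg]; exact Ideal.mem_span_singleton_self g
  have hm0 : m ≠ 0 := by
    rintro rfl
    obtain ⟨w, hw, hw0⟩ := Submodule.exists_mem_ne_zero_of_ne_bot hJ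
    have h1 : ((w.norm : ℤ) : ℤ√(k : ℤ)) ∈ J := by
      rw [norm_eq_mul_conj]; exact J.mul_mem_right _ hw
    exact Zsqrtd.norm_ne_zero hw0 (zero_dvd_iff.1 (hB h1))
  obtain ⟨a, rfl⟩ : g ∣ m := by
    have := hA (J.mul_mem_left sqrtd hmJ)
    simpa using this
  obtain ⟨t, rfl⟩ : g ∣ x₀ := by
    have := hA (J.mul_mem_left sqrtd hx₀)
    simpa using this
  have hg0 : g ≠ 0 := left_ne_zero_of_mul hm0
  -- Multiplying `g(t + √k) ∈ J` by `t - √k` gives an integer of `J`.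
  obtain ⟨c, hc⟩ : a ∣ t ^ 2 - k := by
    have h1 : ((g * (t ^ 2 - k) : ℤ) : ℤ√(k : ℤ)) ∈ J := by
      have := J.mul_mem_left (⟨t, -1⟩ : ℤ√(k : ℤ)) hx₀
      convert this using 1
      ext
      · simp only [re_intCast, re_mul]; ring
      · simp only [im_intCast, im_mul]; ring
    exact (mul_dvd_mul_iff_left hg0).1 (hB h1)
  have hf : (⟨a, 2 * t, c⟩ : BinaryForm).discr = 4 * k := by
    simp only [discr]; linear_combination 4 * hc
  have ht : 2 * t / 2 = t := by omega
  refine ⟨g, ⟨a, 2 * t, c⟩, hg0, hf, ?_⟩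
  ext w
  rw [Ideal.mem_span_singleton_mul]
  constructor
  · intro hw
    obtain ⟨y, hy⟩ := hA hw
    have h1 : ((w.re - g * t * y : ℤ) : ℤ√(k : ℤ)) ∈ J := by
      have := J.sub_mem hw (J.mul_mem_left (y : ℤ√(k : ℤ)) hx₀)
      convert this using 1
      ext
      · simp; ring
      · simp [hy]; ring
    obtain ⟨u, hu⟩ := hB h1
    refine ⟨_, (mem_toIdeal hf).2 ⟨u, y, rfl⟩, ?_⟩
    ext
    · simp [root, ht]; linear_combination -hu
    · simp [root, hy]
  · rintro ⟨v, hv, rfl⟩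
    obtain ⟨u, y, rfl⟩ := (mem_toIdeal hf).1 hv
    have := J.add_mem (J.mul_mem_left (u : ℤ√(k : ℤ)) hmJ) (J.mul_mem_left (y : ℤ√(k : ℤ)) hx₀)
    convert this using 1
    ext
    · simp [root, ht]; ring
    · simp [root]; ring

/-- The conjugate of an ideal. -/
abbrev conjIdeal {k : ℕ} (J : Ideal (ℤ√(k : ℤ))) : Ideal (ℤ√(k : ℤ)) :=
  J.map (starRingEnd (ℤ√(k : ℤ)))

/-- The ideal generated by the coefficients of the form and its roots. -/
def content (k : ℕ) (f : BinaryForm) : Ideal (ℤ√(k : ℤ)) :=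
  Ideal.span {(f.a : ℤ√(k : ℤ)), f.root k, star (f.root k), (f.c : ℤ√(k : ℤ))}

theorem conjIdeal_span_pair {k : ℕ} (v w : ℤ√(k : ℤ)) :
    conjIdeal (Ideal.span {v, w}) = Ideal.span {star v, star w} := by
  rw [conjIdeal, Ideal.map_span, Set.image_pair]; rfl

theorem conjIdeal_span_singleton {k : ℕ} (v : ℤ√(k : ℤ)) :
    conjIdeal (Ideal.span {v}) = Ideal.span {star v} := by
  rw [conjIdeal, Ideal.map_span, Set.image_singleton]; rfl

theorem star_intCast (k : ℕ) (n : ℤ) : star (n : ℤ√(k : ℤ)) = n := by ext <;> simp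

theorem toIdeal_mul_conjIdeal {k : ℕ} {f : BinaryForm} (hd : f.discr = 4 * k) :
    f.toIdeal k * conjIdeal (f.toIdeal k) = Ideal.span {(f.a : ℤ√(k : ℤ))} * f.content k := by
  have h : f.root k * star (f.root k) = f.a * f.c := by
    rw [← norm_eq_mul_conj, norm_root hd]; push_cast; rfl
  rw [toIdeal, conjIdeal_span_pair, star_intCast, Ideal.span_pair_mul_span_pair, content,
    Ideal.span_mul_span', Set.singleton_mul, Set.image_insert_eq, Set.image_insert_eq,
    Set.image_pair, h, mul_comm (f.root k)]
  congr 1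
  ext w
  simp only [Set.mem_insert_iff, Set.mem_singleton_iff]
  tauto

theorem content_eq_top {k : ℕ} {f : BinaryForm} (hd : f.discr = 4 * k) (hp : f.IsPrimitive) :
    f.content k = ⊤ := by
  rw [Ideal.eq_top_iff_one]
  have ha : (f.a : ℤ√(k : ℤ)) ∈ f.content k := Ideal.subset_span (by simp)
  have hc : (f.c : ℤ√(k : ℤ)) ∈ f.content k := Ideal.subset_span (by simp)
  have hb : (f.b : ℤ√(k : ℤ)) ∈ f.content k := by
    have h1 : f.root k ∈ f.content k := Ideal.subset_span (by simp)
    have h2 : star (f.root k) ∈ f.content k := Ideal.subset_span (by simp)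
    convert Ideal.add_mem _ h1 h2 using 1
    have := two_mul_half_b hd
    ext
    · simp [root]; omega
    · simp [root]
  have e1 := Int.gcd_eq_gcd_ab f.a f.b
  have e2 := Int.gcd_eq_gcd_ab (Int.gcd f.a f.b) f.c
  rw [hp, e1] at e2
  have e3 := congrArg (Int.cast : ℤ → ℤ√(k : ℤ)) e2
  push_cast at e3
  rw [e3]
  exact Ideal.add_mem _ (Ideal.mul_mem_right _ _ (Ideal.add_mem _ (Ideal.mul_mem_right _ _ ha)
    (Ideal.mul_mem_right _ _ hb))) (Ideal.mul_mem_right _ _ hc)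

theorem isPrimitive_of_content_eq_top {k : ℕ} {f : BinaryForm} (hd : f.discr = 4 * k)
    (h : f.content k = ⊤) : f.IsPrimitive := by
  set d := Int.gcd (Int.gcd f.a f.b) f.c with hdd
  have hda : (d : ℤ) ∣ f.a := (Int.gcd_dvd_left _ _).trans (Int.gcd_dvd_left _ _)
  have hdb : (d : ℤ) ∣ f.b := (Int.gcd_dvd_left _ _).trans (Int.gcd_dvd_right _ _)
  have hdc : (d : ℤ) ∣ f.c := Int.gcd_dvd_right _ _
  have hda' : ((d : ℤ) : ℤ√(k : ℤ)) ∣ f.a := (intCast_dvd_intCast _ _).2 hda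
  have hdb' : ((d : ℤ) : ℤ√(k : ℤ)) ∣ f.b := (intCast_dvd_intCast _ _).2 hdb
  have hdc' : ((d : ℤ) : ℤ√(k : ℤ)) ∣ f.c := (intCast_dvd_intCast _ _).2 hdc
  have h2 : f.root k + star (f.root k) = (f.b : ℤ√(k : ℤ)) := by
    have := two_mul_half_b hd
    ext
    · simp [root]; omega
    · simp [root]
  have h3 : f.root k * star (f.root k) = f.a * f.c := by
    rw [← norm_eq_mul_conj, norm_root hd]; push_cast; rfl
  -- The content need not lie in `(d)`, as the root is not divisible by `d`; its product with the
  -- root does. If the content contains `1`, then `d` divides the root, whose `√k`-coefficient is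
  -- `1`.
  have key : f.content k ≤ Submodule.comap (LinearMap.mulRight (ℤ√(k : ℤ)) (f.root k))
      (Ideal.span {((d : ℤ) : ℤ√(k : ℤ))}) := by
    rw [content, Ideal.span_le]
    intro w hw
    rw [SetLike.mem_coe, Submodule.mem_comap, LinearMap.mulRight_apply, Ideal.mem_span_singleton]
    rcases hw with rfl | rfl | rfl | rfl
    · exact hda'.mul_right _
    · have : f.root k * f.root k = f.b * f.root k - f.a * f.c := by
        rw [← h2, ← h3]; ring
      rw [this]
      exact dvd_sub (hdb'.mul_right _) (hda'.mul_right _)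
    · rw [mul_comm, h3]
      exact hda'.mul_right _
    · exact hdc'.mul_right _
  have h1 : (1 : ℤ√(k : ℤ)) ∈ f.content k := h ▸ Submodule.mem_top
  have h4 := key h1
  rw [Submodule.mem_comap, LinearMap.mulRight_apply, Ideal.mem_span_singleton, one_mul,
    intCast_dvd] at h4
  have h5 : (d : ℤ) ∣ 1 := h4.2
  exact_mod_cast Int.eq_one_of_dvd_one (by positivity) h5

/-- The form `-f(X, -Y)`. -/
def negConj (f : BinaryForm) : BinaryForm := ⟨-f.a, f.b, -f.c⟩

theorem discr_negConj (f : BinaryForm) : f.negConj.discr = f.discr := by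
  simp [discr, negConj]

theorem toIdeal_negConj (k : ℕ) (f : BinaryForm) : f.negConj.toIdeal k = f.toIdeal k := by
  rw [toIdeal, toIdeal]
  simp only [negConj, root, Int.cast_neg]
  rw [Ideal.span_insert, Ideal.span_insert, Ideal.span_singleton_neg]

/-- Every class can be multiplied by an invertible ideal `L` of norm `|N|`. -/
theorem exists_linked {k : ℕ} [Zsqrtd.Nonsquare k] (hk : ¬ IsSquare k) {L : Ideal (ℤ√(k : ℤ))}
    {N : ℤ} (hN : N ≠ 0) (hL : L * conjIdeal L = Ideal.span {(N : ℤ√(k : ℤ))}) {f : BinaryForm}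
    (hd : f.discr = 4 * k) (hp : f.IsPrimitive) :
    ∃ g : BinaryForm, g.discr = 4 * k ∧ g.IsPrimitive ∧ Linked k L N f g := by
  have ha := a_ne_zero hk hd
  have hJ : L * f.toIdeal k * conjIdeal (L * f.toIdeal k) =
      Ideal.span {((N * f.a : ℤ) : ℤ√(k : ℤ))} := by
    rw [conjIdeal, Ideal.map_mul, mul_mul_mul_comm]
    change L * conjIdeal L * (f.toIdeal k * conjIdeal (f.toIdeal k)) = _
    rw [hL, toIdeal_mul_conjIdeal hd, content_eq_top hd hp, Ideal.mul_top,
      Ideal.span_singleton_mul_span_singleton, Int.cast_mul]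
  have hJ0 : L * f.toIdeal k ≠ ⊥ := by
    intro h0
    rw [h0, Ideal.bot_mul, eq_comm, Ideal.span_singleton_eq_bot] at hJ
    exact mul_ne_zero hN ha (by exact_mod_cast hJ)
  obtain ⟨g, f', hg, hd', hJ'⟩ := exists_span_mul_toIdeal hJ0
  have ha' := a_ne_zero hk hd'
  have key : ∀ e : BinaryForm, e.discr = 4 * k →
      L * f.toIdeal k = Ideal.span {(g : ℤ√(k : ℤ))} * e.toIdeal k →
      Ideal.span {((g ^ 2 * e.a : ℤ) : ℤ√(k : ℤ))} * e.content k =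
        Ideal.span {((N * f.a : ℤ) : ℤ√(k : ℤ))} := by
    intro e he hJe
    rw [← hJ, hJe, conjIdeal, Ideal.map_mul, mul_mul_mul_comm]
    change _ = Ideal.span {(g : ℤ√(k : ℤ))} * conjIdeal (Ideal.span {(g : ℤ√(k : ℤ))}) *
      (e.toIdeal k * conjIdeal (e.toIdeal k))
    rw [conjIdeal_span_singleton, star_intCast, toIdeal_mul_conjIdeal he, ← mul_assoc,
      Ideal.span_singleton_mul_span_singleton, Ideal.span_singleton_mul_span_singleton]
    push_cast
    rw [sq]
  have h1 := key f' hd' hJ'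
  -- The root of `f'` lies in its content and has `√k`-coefficient `1`, so the integer factor can be
  -- read off.
  have hdvd : N * f.a ∣ g ^ 2 * f'.a := by
    have : ((g ^ 2 * f'.a : ℤ) : ℤ√(k : ℤ)) * f'.root k ∈
        Ideal.span {((N * f.a : ℤ) : ℤ√(k : ℤ))} := by
      rw [← h1]
      exact Ideal.mul_mem_mul (Ideal.mem_span_singleton_self _) (Ideal.subset_span (by simp))
    rw [Ideal.mem_span_singleton, intCast_dvd, im_smul] at this
    simpa [root] using this.2
  have hdvd' : g ^ 2 * f'.a ∣ N * f.a := by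
    have : ((N * f.a : ℤ) : ℤ√(k : ℤ)) ∈ Ideal.span {((g ^ 2 * f'.a : ℤ) : ℤ√(k : ℤ))} := by
      have h2 : ((N * f.a : ℤ) : ℤ√(k : ℤ)) ∈ Ideal.span {((N * f.a : ℤ) : ℤ√(k : ℤ))} :=
        Ideal.mem_span_singleton_self _
      rw [← h1] at h2
      exact Ideal.mem_left_of_mem_mul h2
    rwa [Ideal.mem_span_singleton, intCast_dvd_intCast] at this
  have finish : ∀ e : BinaryForm, e.discr = 4 * k →
      L * f.toIdeal k = Ideal.span {(g : ℤ√(k : ℤ))} * e.toIdeal k → g ^ 2 * e.a = N * f.a →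
      ∃ g : BinaryForm, g.discr = 4 * k ∧ g.IsPrimitive ∧ Linked k L N f g := by
    intro e he hJe hae
    refine ⟨e, he, isPrimitive_of_content_eq_top he ?_, g, 1, by exact_mod_cast hg, one_ne_zero,
      ?_, ?_⟩
    · have h3 := key e he hJe
      rw [hae] at h3
      have h4 : ((N * f.a : ℤ) : ℤ√(k : ℤ)) ≠ 0 := by exact_mod_cast mul_ne_zero hN ha
      rw [← Ideal.span_singleton_mul_right_inj h4, h3, Ideal.mul_top]
    · rw [Ideal.span_singleton_one, Ideal.top_mul, hJe]
    · rw [norm_intCast, Zsqrtd.norm_one]; linear_combination hae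
  rcases Int.associated_iff.1 (associated_of_dvd_dvd hdvd' hdvd) with h2 | h2
  · exact finish f' hd' hJ' h2
  -- The ideal fixes the form only up to `negConj`, which corrects the sign.
  · refine finish f'.negConj (by rw [discr_negConj, hd']) (by rw [toIdeal_negConj, hJ']) ?_
    simp only [negConj]; linarith

/-- A class fixed by multiplication with `L` makes `L` principal. -/
theorem Linked.exists_generator {k : ℕ} [Zsqrtd.Nonsquare k] (hk : ¬ IsSquare k)
    {L : Ideal (ℤ√(k : ℤ))} {N : ℤ} {f : BinaryForm} (hd : f.discr = 4 * k) (hp : f.IsPrimitive)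
    (h : Linked k L N f f) : ∃ δ : ℤ√(k : ℤ), δ.norm = N ∧ L = Ideal.span {δ} := by
  obtain ⟨β, γ, hβ, hγ, hI, hn⟩ := h
  have ha := a_ne_zero hk hd
  have ha' : (f.a : ℤ√(k : ℤ)) ≠ 0 := by exact_mod_cast ha
  have h1 : Ideal.span {β} = Ideal.span {γ} * L := by
    have h2 : Ideal.span {β} * (f.toIdeal k * conjIdeal (f.toIdeal k)) =
        Ideal.span {γ} * L * (f.toIdeal k * conjIdeal (f.toIdeal k)) := by
      rw [← mul_assoc, ← mul_assoc, hI]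
    rw [toIdeal_mul_conjIdeal hd, content_eq_top hd hp, Ideal.mul_top,
      mul_comm, mul_comm _ (Ideal.span {(f.a : ℤ√(k : ℤ))})] at h2
    exact (Ideal.span_singleton_mul_right_inj ha').1 h2
  obtain ⟨δ, rfl⟩ : γ ∣ β := by
    rw [← Ideal.mem_span_singleton]
    have h2 : β ∈ Ideal.span {β} := Ideal.mem_span_singleton_self _
    rw [h1] at h2
    exact Ideal.mem_left_of_mem_mul h2
  refine ⟨δ, ?_, ?_⟩
  · rw [Zsqrtd.norm_mul] at hn
    apply mul_left_cancel₀ (mul_ne_zero (Zsqrtd.norm_ne_zero hγ) ha)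
    linear_combination hn
  · rw [← Ideal.span_singleton_mul_span_singleton] at h1
    exact ((Ideal.span_singleton_mul_right_inj hγ).1 h1).symm

end BinaryForm

/-! ### Finiteness of the class number and the action of `L` on classes. -/

namespace BinaryForm

theorem ProperEquiv.discr_eq {f g : BinaryForm} (h : ProperEquiv f g) : g.discr = f.discr := by
  obtain ⟨p, q, r, s, hd, ha, hb, hc⟩ := h.coeffs
  simp only [discr, eval, ha, hb, hc]
  linear_combination (f.b ^ 2 - 4 * f.a * f.c) * (p * s - q * r + 1) * hd

theorem isPrimitive_iff {f : BinaryForm} :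
    f.IsPrimitive ↔ ∀ d : ℤ, d ∣ f.a → d ∣ f.b → d ∣ f.c → IsUnit d := by
  constructor
  · intro h d ha hb hc
    have := Int.dvd_coe_gcd (Int.dvd_coe_gcd ha hb) hc
    rw [h] at this
    exact isUnit_of_dvd_one (by exact_mod_cast this)
  · intro h
    have := h (Int.gcd (Int.gcd f.a f.b) f.c) ((Int.gcd_dvd_left _ _).trans (Int.gcd_dvd_left _ _))
      ((Int.gcd_dvd_left _ _).trans (Int.gcd_dvd_right _ _)) (Int.gcd_dvd_right _ _)
    rw [Int.isUnit_iff_natAbs_eq] at this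
    exact this

theorem ProperEquiv.isPrimitive {f g : BinaryForm} (h : ProperEquiv f g) (hf : f.IsPrimitive) :
    g.IsPrimitive := by
  rw [isPrimitive_iff] at hf ⊢
  intro d ha hb hc
  obtain ⟨p, q, r, s, -, ha', hb', hc'⟩ := h.symm.coeffs
  obtain ⟨a, ha⟩ := ha
  obtain ⟨b, hb⟩ := hb
  obtain ⟨c, hc⟩ := hc
  apply hf d
  · rw [ha', eval, ha, hb, hc]; exact ⟨a * p ^ 2 + b * p * r + c * r ^ 2, by ring⟩
  · rw [hb', ha, hb, hc]; exact ⟨2 * a * p * q + b * (p * s + q * r) + 2 * c * r * s, by ring⟩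
  · rw [hc', eval, ha, hb, hc]; exact ⟨a * q ^ 2 + b * q * s + c * s ^ 2, by ring⟩

theorem properEquiv_translate (f : BinaryForm) (t : ℤ) :
    ProperEquiv f ⟨f.a, f.b + 2 * f.a * t, f.eval t 1⟩ :=
  ⟨1, t, 0, 1, by ring, fun X Y => by simp only [eval]; ring⟩

theorem properEquiv_swap (f : BinaryForm) : ProperEquiv f ⟨f.c, -f.b, f.a⟩ :=
  ⟨0, -1, 1, 0, by ring, fun X Y => by simp only [eval]; ring⟩

/-- Take `|a|` minimal in the class: a translation makes `|b| ≤ |a|`, and the swap shows that `|c|`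
is no smaller than `|a|`. -/
theorem exists_reduced (f : BinaryForm) (h : ∀ g, ProperEquiv f g → g.a ≠ 0) :
    ∃ g, ProperEquiv f g ∧ |g.b| ≤ |g.a| ∧ |g.a| ≤ |g.c| := by
  classical
  have hex : ∃ n : ℕ, ∃ g, ProperEquiv f g ∧ g.a.natAbs = n := ⟨_, f, ProperEquiv.refl f, rfl⟩
  obtain ⟨g, hg, hn⟩ := Nat.find_spec hex
  have hmin : ∀ e, ProperEquiv f e → |g.a| ≤ |e.a| := by
    intro e he
    rw [Int.abs_eq_natAbs, Int.abs_eq_natAbs]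
    exact_mod_cast hn.trans_le (Nat.find_min' hex ⟨e, he, rfl⟩)
  have ha : g.a ≠ 0 := h g hg
  obtain ⟨t, ht⟩ : ∃ t : ℤ, |g.b + 2 * g.a * t| ≤ |g.a| := by
    have h1 := Int.emod_add_mul_ediv (g.b + |g.a|) (2 * g.a)
    have h2 := Int.emod_nonneg (g.b + |g.a|) (b := 2 * g.a) (by omega)
    have h3 := Int.emod_lt_abs (g.b + |g.a|) (b := 2 * g.a) (by omega)
    rw [abs_mul, abs_two] at h3
    refine ⟨-((g.b + |g.a|) / (2 * g.a)), ?_⟩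
    rw [mul_neg, abs_le]
    constructor <;> linarith
  refine ⟨_, hg.trans (properEquiv_translate g t), ht, ?_⟩
  exact hmin _ ((hg.trans (properEquiv_translate g t)).trans (properEquiv_swap _))

theorem abs_coeffs_le {k : ℕ} {g : BinaryForm} (hd : g.discr = 4 * k) (ha : g.a ≠ 0)
    (hba : |g.b| ≤ |g.a|) (hac : |g.a| ≤ |g.c|) : |g.a| ≤ k ∧ |g.b| ≤ k ∧ |g.c| ≤ k := by
  have ha1 : 1 ≤ |g.a| := Int.one_le_abs ha
  have h1 : g.b ^ 2 ≤ |g.a| * |g.c| := by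
    rw [← sq_abs, sq]
    exact mul_le_mul hba (hba.trans hac) (abs_nonneg _) (abs_nonneg _)
  have hk : (0 : ℤ) ≤ k := by positivity
  unfold discr at hd
  have h2 : |g.c| ≤ k := by
    rw [← abs_mul] at h1
    rcases le_or_gt 0 (g.a * g.c) with h3 | h3
    · rw [abs_of_nonneg h3] at h1
      have h4 : g.a * g.c = 0 := by nlinarith
      have h5 := (mul_eq_zero.1 h4).resolve_left ha
      rw [h5, abs_zero]; exact hk
    · have h4 : |g.a| * |g.c| ≤ k := by
        rw [← abs_mul, abs_of_neg h3]
        nlinarith [sq_nonneg g.b]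
      nlinarith [abs_nonneg g.c]
  exact ⟨hac.trans h2, (hba.trans hac).trans h2, h2⟩

/-- There are finitely many classes of primitive forms of discriminant `4k`. -/
theorem finite_classes {k : ℕ} (hk : ¬ IsSquare k) : Finite (Quotient (properSetoid (4 * k))) := by
  let S := {f : {f : BinaryForm // f.discr = 4 * k ∧ f.IsPrimitive} //
    |f.1.a| ≤ k ∧ |f.1.b| ≤ k ∧ |f.1.c| ≤ k}
  have hS : Finite S := by
    let F : S → Set.Icc (-(k : ℤ)) k × Set.Icc (-(k : ℤ)) k × Set.Icc (-(k : ℤ)) k := fun f =>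
      (⟨f.1.1.a, abs_le.1 f.2.1⟩, ⟨f.1.1.b, abs_le.1 f.2.2.1⟩, ⟨f.1.1.c, abs_le.1 f.2.2.2⟩)
    apply Finite.of_injective F
    intro f g h
    simp only [F, Prod.mk.injEq] at h
    exact Subtype.ext (Subtype.ext (BinaryForm.ext (congrArg Subtype.val h.1)
      (congrArg Subtype.val h.2.1) (congrArg Subtype.val h.2.2)))
  apply Finite.of_surjective (fun f : S => (Quotient.mk (properSetoid (4 * k)) f.1))
  intro q
  induction q using Quotient.inductionOn with
  | h f =>
    have hne : ∀ g, ProperEquiv f.1 g → g.a ≠ 0 := fun g hg =>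
      a_ne_zero hk (hg.discr_eq.trans f.2.1)
    obtain ⟨g, hg, hba, hac⟩ := exists_reduced f.1 hne
    exact ⟨⟨⟨g, hg.discr_eq.trans f.2.1, hg.isPrimitive f.2.2⟩,
      abs_coeffs_le (hg.discr_eq.trans f.2.1) (hne g hg) hba hac⟩, Quotient.sound hg.symm⟩

/-- An invertible ideal whose `p`-th power is principal is itself principal, or else `p` divides
the class number. Generators are to have norms of the prescribed sign. -/
theorem exists_generator_or_dvd_classNumber {k : ℕ} [Zsqrtd.Nonsquare k] (hk : ¬ IsSquare k)
    {L : Ideal (ℤ√(k : ℤ))} {N : ℤ} (hN : N ≠ 0)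
    (hL : L * conjIdeal L = Ideal.span {(N : ℤ√(k : ℤ))}) {p : ℕ} (hp : p.Prime) {α : ℤ√(k : ℤ)}
    (hα : L ^ p = Ideal.span {α}) (hαN : α.norm = N ^ p) :
    (∃ δ : ℤ√(k : ℤ), δ.norm = N ∧ L = Ideal.span {δ}) ∨ p ∣ classNumber (4 * k) := by
  classical
  by_cases hδ : ∃ δ : ℤ√(k : ℤ), δ.norm = N ∧ L = Ideal.span {δ}
  · exact Or.inl hδ
  right
  have hout : ∀ q : Quotient (properSetoid (4 * k)), q.out.1.discr = 4 * k := fun q => q.out.2.1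
  have step : ∀ q : Quotient (properSetoid (4 * k)), ∃ q' : Quotient (properSetoid (4 * k)),
      Linked k L N q.out.1 q'.out.1 := by
    intro q
    obtain ⟨g, hg, hgp, hl⟩ := exists_linked hk hN hL q.out.2.1 q.out.2.2
    refine ⟨Quotient.mk _ ⟨g, hg, hgp⟩, ?_⟩
    have h1 : ProperEquiv (Quotient.mk (properSetoid (4 * k)) ⟨g, hg, hgp⟩).out.1 g :=
      Quotient.mk_out (s := properSetoid (4 * k)) ⟨g, hg, hgp⟩
    simpa using hl.mul (h1.symm.linked hk hg (hout _))
  choose T hT using step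
  have iter : ∀ j q, Linked k (L ^ j) (N ^ j) q.out.1 (T^[j] q).out.1 := by
    intro j
    induction j with
    | zero =>
      intro q
      simpa using (ProperEquiv.refl q.out.1).linked hk q.out.2.1 q.out.2.1
    | succ j ih =>
      intro q
      rw [Function.iterate_succ_apply', pow_succ, pow_succ]
      exact (ih q).mul (hT _)
  have hper : ∀ q, T^[p] q = q := by
    intro q
    have h1 := iter p q
    rw [hα, ← hαN] at h1
    have h2 := h1.properEquiv hk (hout _) (hout _)
    have h3 : (Quotient.mk (properSetoid (4 * k)) q.out) = Quotient.mk _ (T^[p] q).out :=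
      Quotient.sound h2
    rw [Quotient.out_eq, Quotient.out_eq] at h3
    exact h3.symm
  have := finite_classes hk
  have := Fintype.ofFinite (Quotient (properSetoid (4 * k)))
  have : Fact p.Prime := ⟨hp⟩
  -- A fixed class would make `L` principal. Without fixed points, all orbits of `T` have length
  -- `p`.
  have hfix : ∀ q, T q ≠ q := by
    intro q hq
    have h1 := hT q
    rw [hq] at h1
    exact hδ (h1.exists_generator hk q.out.2.1 q.out.2.2)
  let F : Function.End (Quotient (properSetoid (4 * k))) := T
  have hFp : F ^ p ^ 1 = 1 := by
    rw [pow_one]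
    funext q
    exact (congrFun (hom_coe_pow (fun g : Function.End _ => g) rfl (fun _ _ => rfl) F p) q).trans
      (hper q)
  have hcard := Equiv.Perm.card_fixedPoints_modEq hFp
  rw [classNumber, Nat.card_eq_fintype_card, ← Nat.modEq_zero_iff_dvd]
  refine hcard.trans ?_
  have hempty : IsEmpty (Function.fixedPoints F) := ⟨fun q => hfix q.1 q.2⟩
  rw [Fintype.card_eq_zero]

/-! ### The ideal `(N, α)` and its powers. -/

theorem span_pair_pow_le {k : ℕ} (v w : ℤ√(k : ℤ)) (j : ℕ) (hj : j ≠ 0) :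
    Ideal.span {v, w} ^ j ≤ Ideal.span {v ^ j} ⊔ Ideal.span {w} := by
  induction j, Nat.one_le_iff_ne_zero.2 hj using Nat.le_induction with
  | base => rw [pow_one, pow_one, Ideal.span_insert]
  | succ j hj ih =>
    rw [pow_succ, pow_succ, ← Ideal.span_singleton_mul_span_singleton, Ideal.span_insert v]
    refine (Ideal.mul_mono_left ((ih (by omega)).trans' (by rw [Ideal.span_insert]))).trans ?_
    rw [Ideal.sup_mul, Ideal.mul_sup, Ideal.mul_sup]
    exact sup_le (sup_le le_sup_left (Ideal.mul_le_right.trans le_sup_right))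
      (sup_le (Ideal.mul_le_left.trans le_sup_right) (Ideal.mul_le_left.trans le_sup_right))

/-- The product is `(N)(N, ᾱ, α, M)`, and the second factor contains the coprime integers `N` and `α
+ ᾱ`. -/
theorem span_pair_mul_conjIdeal {k : ℕ} {α : ℤ√(k : ℤ)} {N M : ℤ} (hα : α.norm = N * M)
    (hco : IsCoprime N (2 * α.re)) :
    Ideal.span {(N : ℤ√(k : ℤ)), α} * conjIdeal (Ideal.span {(N : ℤ√(k : ℤ)), α}) =
      Ideal.span {(N : ℤ√(k : ℤ))} := by
  have h : α * star α = N * M := by rw [← norm_eq_mul_conj, hα]; push_cast; rfl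
  have htop : Ideal.span {(N : ℤ√(k : ℤ)), star α, α, (M : ℤ√(k : ℤ))} = ⊤ := by
    rw [Ideal.eq_top_iff_one]
    obtain ⟨u, v, huv⟩ := hco
    have h1 : (1 : ℤ√(k : ℤ)) = u * N + v * (star α + α) := by
      ext
      · simp; linarith
      · simp
    rw [h1]
    refine Ideal.add_mem _ (Ideal.mul_mem_left _ _ (Ideal.subset_span (by simp)))
      (Ideal.mul_mem_left _ _ (Ideal.add_mem _ (Ideal.subset_span (by simp))
        (Ideal.subset_span (by simp))))
  rw [conjIdeal_span_pair, star_intCast, Ideal.span_pair_mul_span_pair, h, mul_comm α]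
  conv_rhs => rw [← Ideal.mul_top (Ideal.span {(N : ℤ√(k : ℤ))}), ← htop, Ideal.span_mul_span',
    Set.singleton_mul, Set.image_insert_eq, Set.image_insert_eq, Set.image_pair]

theorem span_pair_pow {k : ℕ} [Zsqrtd.Nonsquare k] {α : ℤ√(k : ℤ)} {N : ℤ} {j : ℕ} (hj : j ≠ 0)
    (hN : N ≠ 0) (hα : α.norm = N ^ j) (hco : IsCoprime N (2 * α.re)) :
    Ideal.span {(N : ℤ√(k : ℤ)), α} ^ j = Ideal.span {α} := by
  have hc := span_pair_mul_conjIdeal (M := N ^ (j - 1))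
    (by rw [hα, mul_comm, pow_sub_one_mul hj]) hco
  have hαα : ((N ^ j : ℤ) : ℤ√(k : ℤ)) = α * star α := by rw [← norm_eq_mul_conj, hα]
  set L := Ideal.span {(N : ℤ√(k : ℤ)), α}
  have hα0 : star α ≠ 0 := by
    intro h0
    rw [h0, mul_zero] at hαα
    exact pow_ne_zero j hN (by exact_mod_cast hαα)
  have hle : L ^ j ≤ Ideal.span {α} := by
    refine (span_pair_pow_le _ _ j hj).trans (sup_le ?_ le_rfl)
    rw [Ideal.span_singleton_le_span_singleton]
    exact ⟨star α, by rw [← hαα]; push_cast; rfl⟩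
  refine hle.antisymm ?_
  have hle' : conjIdeal L ^ j ≤ Ideal.span {star α} := by
    rw [conjIdeal, ← Ideal.map_pow, ← conjIdeal_span_singleton]
    exact Ideal.map_mono hle
  -- The reverse inclusion follows from `(ᾱ)(α) = (N^j) = L̄^j L^j ⊆ (ᾱ) L^j` by cancelling `ᾱ`.
  have h1 : Ideal.span {star α} * Ideal.span {α} ≤ Ideal.span {star α} * L ^ j := by
    calc Ideal.span {star α} * Ideal.span {α} = Ideal.span {(N : ℤ√(k : ℤ))} ^ j := by
          rw [Ideal.span_singleton_mul_span_singleton, mul_comm, ← hαα, Ideal.span_singleton_pow]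
          push_cast; rfl
      _ = conjIdeal L ^ j * L ^ j := by rw [← hc, mul_pow, mul_comm]
      _ ≤ _ := Ideal.mul_mono_left hle'
  exact (Ideal.span_singleton_mul_right_mono hα0).1 h1

end BinaryForm

/-! ### Pell units and the normalisation of the ratio. -/

/-- `u + v√k` as a real number. -/
noncomputable abbrev Zsqrtd.real (k : ℕ) : ℤ√(k : ℤ) →+* ℝ := toReal (Int.natCast_nonneg k)

theorem Zsqrtd.real_apply {k : ℕ} (w : ℤ√(k : ℤ)) : real k w = w.re + w.im * √(k : ℝ) := by
  simp [real]

theorem Zsqrtd.real_star {k : ℕ} (w : ℤ√(k : ℤ)) : real k (star w) = w.re - w.im * √(k : ℝ) := by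
  rw [real_apply]; simp; ring

theorem Zsqrtd.real_mul_real_star {k : ℕ} (w : ℤ√(k : ℤ)) :
    real k w * real k (star w) = w.norm := by
  rw [← map_mul, ← norm_eq_mul_conj, map_intCast]

theorem not_isSquare_intCast {k : ℕ} (hsq : ¬ IsSquare k) (n : ℤ) : (k : ℤ) ≠ n * n := by
  intro h
  exact hsq ⟨n.natAbs, by zify; rw [h, ← sq, ← sq, sq_abs]⟩

/-- The least Pell solution, as an element of `ℤ[√k]`. -/
theorem exists_isLeastPellSolution {k : ℕ} (hk : 1 < k) (hsq : ¬ IsSquare k) :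
    ∃ ε : ℤ√(k : ℤ), ε.norm = 1 ∧ 1 < real k ε ∧ IsLeastPellSolution k ε.re ε.im := by
  have hk0 : (0 : ℤ) < k := by omega
  obtain ⟨E, hE⟩ := Pell.IsFundamental.exists_of_not_isSquare hk0
    (fun ⟨n, hn⟩ => not_isSquare_intCast hsq n hn)
  have hs : 0 < √(k : ℝ) := Real.sqrt_pos.2 (by positivity)
  have hx1 : 1 < E.x := hE.1
  have hy1 : 0 < E.y := hE.2.1
  refine ⟨⟨E.x, E.y⟩, ?_, ?_, by change 0 < E.x; omega, hy1, E.prop, ?_⟩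
  · rw [norm_def]; linear_combination E.prop
  · rw [real_apply]
    have h1 : (1 : ℝ) < E.x := by exact_mod_cast hx1
    have h2 : (0 : ℝ) < E.y := by exact_mod_cast hy1
    have := mul_pos h2 hs
    change (1 : ℝ) < E.x + E.y * √(k : ℝ)
    linarith
  · intro U V hU hV h
    have hU1 : 1 < U := by
      by_contra! h1
      have : U = 1 := by omega
      subst this
      have := mul_pos hk0 (pow_pos hV 2)
      linarith
    have h1 : E.x ≤ U := hE.x_le_x (a := Pell.Solution₁.mk U V h) hU1
    have h2 : E.y ≤ V := hE.y_le_y (a := Pell.Solution₁.mk U V h) hU1 hV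
    have h1' : (E.x : ℝ) ≤ U := by exact_mod_cast h1
    have h2' : (E.y : ℝ) ≤ V := by exact_mod_cast h2
    change (E.x : ℝ) + E.y * √(k : ℝ) ≤ _
    gcongr

theorem exists_unit_real_eq_zpow {k : ℕ} {ε : ℤ√(k : ℤ)} (hε : ε.norm = 1) (n : ℤ) :
    ∃ w : ℤ√(k : ℤ), w.norm = 1 ∧ real k w = real k ε ^ n := by
  have hpow : ∀ (w : ℤ√(k : ℤ)), w.norm = 1 → ∀ m : ℕ, (w ^ m).norm = 1 := by
    intro w hw m
    have := map_pow (normMonoidHom (d := k)) w m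
    change (w ^ m).norm = w.norm ^ m at this
    rw [this, hw, one_pow]
  obtain ⟨m, rfl | rfl⟩ := n.eq_nat_or_neg
  · exact ⟨ε ^ m, hpow _ hε m, by rw [map_pow, zpow_natCast]⟩
  · refine ⟨star ε ^ m, hpow _ (by rw [norm_conj, hε]) m, ?_⟩
    have h := real_mul_real_star ε
    rw [hε, Int.cast_one] at h
    rw [map_pow, zpow_neg, zpow_natCast, ← inv_pow, eq_inv_of_mul_eq_one_right h]

/-- Multiplying by a unit brings the ratio of an element to its conjugate into `(1 / e, e]`. -/
theorem exists_unit_ratio_mem {k : ℕ} {ε : ℤ√(k : ℤ)} (hε : ε.norm = 1) (hε1 : 1 < real k ε)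
    {δ : ℤ√(k : ℤ)} (hδ : δ.norm ≠ 0) :
    ∃ w : ℤ√(k : ℤ), w.norm = 1 ∧
      |real k (star (δ * w))| < real k ε * |real k (δ * w)| ∧
      |real k (δ * w)| ≤ real k ε * |real k (star (δ * w))| := by
  set e := real k ε
  have he0 : 0 < e := by linarith
  have hd := real_mul_real_star δ
  have hd0 : (δ.norm : ℝ) ≠ 0 := by exact_mod_cast hδ
  have h1 : 0 < |real k δ| := abs_pos.2 (left_ne_zero_of_mul (hd ▸ hd0))
  have h2 : 0 < |real k (star δ)| := abs_pos.2 (right_ne_zero_of_mul (hd ▸ hd0))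
  -- Multiplying by `e^(-n)` divides the ratio by `e^(2n)`, hence the base `e^2`; the extra factor
  -- `e` centres the window at `1`.
  obtain ⟨n, hn1, hn2⟩ := exists_mem_Ioc_zpow (x := |real k δ| / |real k (star δ)| * e)
    (y := e ^ 2) (by positivity) (by nlinarith)
  obtain ⟨w, hw, hwe⟩ := exists_unit_real_eq_zpow hε (-n)
  have hwe' : real k (star w) = e ^ n := by
    have h := real_mul_real_star w
    rw [hw, Int.cast_one, hwe, zpow_neg] at h
    rw [eq_inv_of_mul_eq_one_right h, inv_inv]
  have hp : 0 < e ^ n := zpow_pos he0 n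
  have hsq : (e ^ 2) ^ n = e ^ n * e ^ n := by rw [sq, mul_zpow]
  have hsq' : (e ^ 2) ^ (n + 1) = e ^ n * e ^ n * e ^ 2 := by
    rw [zpow_add_one₀ (by positivity), hsq]
  refine ⟨w, hw, ?_, ?_⟩
  · rw [star_mul', map_mul, map_mul, abs_mul, abs_mul, hwe, hwe', zpow_neg, abs_inv, abs_of_pos hp]
    rw [hsq, div_mul_eq_mul_div, lt_div_iff₀ h2] at hn1
    rw [← div_eq_mul_inv, mul_div_assoc', lt_div_iff₀ hp]
    linarith
  · rw [star_mul', map_mul, map_mul, abs_mul, abs_mul, hwe, hwe', zpow_neg, abs_inv, abs_of_pos hp]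
    rw [hsq', div_mul_eq_mul_div, div_le_iff₀ h2] at hn2
    rw [← div_eq_mul_inv, div_le_iff₀ hp]
    have : e * |real k δ| ≤ e * (e * (|real k (star δ)| * e ^ n) * e ^ n) := by
      linarith
    exact le_of_mul_le_mul_left this he0

/-- In the ratio of an element of norm `-M` to its conjugate, the bound `e` is not attained. -/
theorem ratio_ne {k : ℕ} (hsq : ¬ IsSquare k) {ε δ : ℤ√(k : ℤ)} {M : ℤ} (hM : 1 < M)
    (hMo : Odd M) (hMk : IsCoprime (k : ℤ) M) (hδ : δ.norm = -M) (hco : IsCoprime δ.re δ.im) :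
    |real k δ| ≠ real k ε * |real k (star δ)| := by
  intro h
  have h1 : |real k δ| * |real k (star δ)| = M := by
    rw [← abs_mul, real_mul_real_star, hδ]
    push_cast
    rw [abs_neg, abs_of_pos (by exact_mod_cast (by omega : 0 < M))]
  -- Equality would give `δ^2 = Mε`, hence `M ∣ 2 δ.re^2`, although `M` is odd and coprime to
  -- `δ.re`.
  have h2 : real k (δ ^ 2) = real k (M * ε) := by
    rw [map_mul, map_intCast, ← h1, map_pow, ← sq_abs]
    linear_combination |real k δ| * h
  have h3 := toReal_injective (Int.natCast_nonneg k) (not_isSquare_intCast hsq) h2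
  have h4 := congrArg Zsqrtd.re h3
  rw [re_smul, sq, re_mul] at h4
  rw [norm_def] at hδ
  have h5 : M ∣ δ.re ^ 2 := by
    have h6 : M ∣ 2 * δ.re ^ 2 := ⟨ε.re - 1, by linear_combination h4 + hδ⟩
    refine IsCoprime.dvd_of_dvd_mul_left ?_ h6
    obtain ⟨c, hc⟩ := hMo
    exact ⟨1, -c, by rw [hc]; ring⟩
  have h6 : IsCoprime δ.re (k : ℤ) := by
    have : IsCoprime (k : ℤ) (δ.re ^ 2) := by
      have h7 : δ.re ^ 2 = -M + k * δ.im ^ 2 := by linear_combination hδ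
      rw [h7]
      exact (IsCoprime.add_mul_left_right_iff).2 hMk.neg_right
    exact ((IsCoprime.pow_right_iff two_pos).1 this).symm
  have h7 : IsCoprime δ.re M := by
    have h8 : M = k * δ.im ^ 2 + δ.re * (-δ.re) := by linear_combination hδ
    rw [h8]
    exact (IsCoprime.add_mul_left_right_iff).2 (h6.mul_right (hco.pow_right))
  have h8 : IsUnit M := ((h7.pow_left (m := 2)).symm).isUnit_of_dvd' dvd_rfl h5
  rcases Int.isUnit_iff.1 h8 with h9 | h9 <;> omega

theorem Zsqrtd.norm_pow {d : ℤ} (w : ℤ√d) (m : ℕ) : (w ^ m).norm = w.norm ^ m :=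
  map_pow (normMonoidHom (d := d)) w m

theorem abs_ratio_bounds {X Y s e : ℝ} (hX : 0 < X) (hY : 0 < Y) (hs : 0 < s)
    (hne : X - Y * s ≠ 0) (h : |X + Y * s| < e * |X - Y * s|) :
    1 < |(X + Y * s) / (X - Y * s)| ∧ |(X + Y * s) / (X - Y * s)| < e := by
  have h1 : 0 < |X - Y * s| := abs_pos.2 hne
  have h2 := mul_pos hY hs
  rw [abs_div, one_lt_div h1, div_lt_iff₀ h1]
  refine ⟨?_, h⟩
  rw [abs_of_pos (by linarith : 0 < X + Y * s), abs_lt]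
  constructor <;> linarith

theorem exists_reduced_solution {k : ℕ} (hk : 1 < k) (hsq : ¬ IsSquare k) {Z t : ℕ} (hZ : Odd Z)
    {α δ η : ℤ√(k : ℤ)} (hδ : δ.norm = (-(2 * (k : ℤ) - 1)) ^ Z) (hη : η.norm = 1)
    (hα : α = δ ^ t * η) (ht : t ≠ 0) (hco : IsCoprime α.re α.im) :
    ∃ X₁ Y₁ : ℕ, ∃ l u v u₁ v₁ : ℤ, 0 < X₁ ∧ 0 < Y₁ ∧ (l = 1 ∨ l = -1) ∧
      u ^ 2 - k * v ^ 2 = 1 ∧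
      real k α = ((X₁ : ℝ) + l * Y₁ * Real.sqrt k) ^ t * ((u : ℝ) + v * Real.sqrt k) ∧
      (X₁ : ℤ) ^ 2 - k * (Y₁ : ℤ) ^ 2 = (-(2 * (k : ℤ) - 1)) ^ Z ∧
      Nat.gcd X₁ Y₁ = 1 ∧
      IsLeastPellSolution k u₁ v₁ ∧
      1 < |((X₁ : ℝ) + Y₁ * Real.sqrt k) / ((X₁ : ℝ) - Y₁ * Real.sqrt k)| ∧
      |((X₁ : ℝ) + Y₁ * Real.sqrt k) / ((X₁ : ℝ) - Y₁ * Real.sqrt k)| <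
        (u₁ : ℝ) + v₁ * Real.sqrt k := by
  obtain ⟨ε, hε, hε1, hleast⟩ := exists_isLeastPellSolution hk hsq
  set M := (2 * (k : ℤ) - 1) ^ Z with hMdef
  have hδM : δ.norm = -M := by rw [hδ, hZ.neg_pow]
  have hM : 1 < M := one_lt_pow₀ (by omega) hZ.pos.ne'
  have hMo : Odd M := Odd.pow ⟨k - 1, by ring⟩
  have hMk : IsCoprime (k : ℤ) M := IsCoprime.pow_right ⟨2, -1, by ring⟩
  obtain ⟨w, hw, hlow, hup⟩ := exists_unit_ratio_mem hε hε1 (δ := δ) (by omega)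
  have hww : w * star w = 1 := by rw [← norm_eq_mul_conj, hw, Int.cast_one]
  set κ := δ * w with hκ
  have hκn : κ.norm = -M := by rw [hκ, Zsqrtd.norm_mul, hw, hδM, mul_one]
  have hακ : α = κ ^ t * (star w ^ t * η) := by
    rw [hα, hκ, ← mul_assoc, ← mul_pow, mul_assoc δ, hww, mul_one]
  have hcoκ : IsCoprime κ.re κ.im :=
    isCoprime_of_dvd_isCoprime hco ((dvd_pow_self κ ht).trans ⟨_, hακ⟩)
  have hη' : (star w ^ t * η).norm = 1 := by
    rw [Zsqrtd.norm_mul, Zsqrtd.norm_pow, norm_conj, hw, hη, one_pow, mul_one]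
  have hup' := lt_of_le_of_ne hup (ratio_ne hsq hM hMo hMk hκn hcoκ)
  have hn : κ.re ^ 2 - k * κ.im ^ 2 = -M := by rw [← hκn, norm_def]; ring
  have hre : κ.re ≠ 0 := by
    intro h0
    rw [h0] at hn
    have : (k : ℤ) ∣ M := ⟨κ.im ^ 2, by linarith⟩
    have h1 := hMk.isUnit_of_dvd' dvd_rfl this
    rcases Int.isUnit_iff.1 h1 with h2 | h2 <;> omega
  have him : κ.im ≠ 0 := by
    intro h0
    rw [h0] at hn
    nlinarith [sq_nonneg κ.re]
  have hs : 0 < √(k : ℝ) := Real.sqrt_pos.2 (by positivity)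
  have hprod := real_mul_real_star κ
  have hκ0 : (κ.norm : ℝ) ≠ 0 := by rw [hκn]; exact_mod_cast (by omega : -M ≠ 0)
  have hne1 := left_ne_zero_of_mul (hprod ▸ hκ0)
  have hne2 := right_ne_zero_of_mul (hprod ▸ hκ0)
  rw [real_star, real_apply κ] at hlow hup'
  rw [real_star] at hne2
  rw [real_apply] at hne1
  have sign : ∀ n : ℤ, ∃ σ : ℤ, (σ = 1 ∨ σ = -1) ∧ n = σ * n.natAbs := by
    intro n
    rcases n.natAbs_eq with h | h
    · exact ⟨1, Or.inl rfl, by rw [one_mul]; exact h⟩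
    · exact ⟨-1, Or.inr rfl, by rw [neg_one_mul]; exact h⟩
  obtain ⟨σ, hσ, hσX⟩ := sign κ.re
  obtain ⟨τ, hτ, hτY⟩ := sign κ.im
  have hX : 0 < κ.re.natAbs := Int.natAbs_pos.2 hre
  have hY : 0 < κ.im.natAbs := Int.natAbs_pos.2 him
  have hgcd : Nat.gcd κ.re.natAbs κ.im.natAbs = 1 := Int.isCoprime_iff_gcd_eq_one.1 hcoκ
  have hnX : (κ.re.natAbs : ℤ) ^ 2 - k * (κ.im.natAbs : ℤ) ^ 2 = -M := by
    rw [Int.natAbs_sq, Int.natAbs_sq, hn]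
  have hreal : real k ε = ε.re + ε.im * √(k : ℝ) := real_apply ε
  generalize κ.re.natAbs = X at *
  generalize κ.im.natAbs = Y at *
  have hX' : (0 : ℝ) < X := by exact_mod_cast hX
  have hY' : (0 : ℝ) < Y := by exact_mod_cast hY
  have hσ2 : σ * σ = 1 := by rcases hσ with rfl | rfl <;> norm_num
  -- Writing `κ = σ(X + στ Y√k)`, the sign `σ^t` is absorbed into the unit and `στ` becomes `λ`.
  set ξ : ℤ√(k : ℤ) := (σ : ℤ√(k : ℤ)) ^ t * (star w ^ t * η)
  have hξ : ξ.norm = 1 := by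
    rw [Zsqrtd.norm_mul, hη', Zsqrtd.norm_pow, norm_intCast, hσ2, one_pow, mul_one]
  have hκσ : κ = σ * ⟨X, σ * τ * Y⟩ := by
    ext
    · rw [re_smul, hσX]
    · rw [im_smul, hτY]; linear_combination -(τ * Y) * hσ2
  have hαξ : α = (⟨X, σ * τ * Y⟩ : ℤ√(k : ℤ)) ^ t * ξ := by
    rw [hακ, hκσ, mul_pow]; ring
  have hbounds : 1 < |((X : ℝ) + Y * √(k : ℝ)) / (X - Y * √(k : ℝ))| ∧
      |((X : ℝ) + Y * √(k : ℝ)) / (X - Y * √(k : ℝ))| < real k ε := by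
    -- The positive ratio is that of `κ` or its inverse, up to sign; the window `(1/e, e)` is stable
    -- under inversion.
    rw [hσX, hτY] at hlow hup' hne1 hne2
    apply abs_ratio_bounds hX' hY' hs
    · rcases hσ with rfl | rfl <;> rcases hτ with rfl | rfl <;> push_cast at hne1 hne2 <;>
        intro h0
      · apply hne2; linarith
      · apply hne1; linarith
      · apply hne1; linarith
      · apply hne2; linarith
    · rcases hσ with rfl | rfl <;> rcases hτ with rfl | rfl <;> push_cast at hlow hup'
      · simpa using hup'
      · simpa [← sub_eq_add_neg] using hlow
      · rwa [show -1 * (X : ℝ) - 1 * Y * √(k : ℝ) = -(X + Y * √(k : ℝ)) by ring,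
          show -1 * (X : ℝ) + 1 * Y * √(k : ℝ) = -(X - Y * √(k : ℝ)) by ring, abs_neg,
          abs_neg] at hlow
      · rwa [show -1 * (X : ℝ) + -1 * Y * √(k : ℝ) = -(X + Y * √(k : ℝ)) by ring,
          show -1 * (X : ℝ) - -1 * Y * √(k : ℝ) = -(X - Y * √(k : ℝ)) by ring, abs_neg,
          abs_neg] at hup'
  refine ⟨X, Y, σ * τ, ξ.re, ξ.im, ε.re, ε.im, hX, hY, ?_, ?_, ?_, ?_, hgcd, hleast, hbounds.1, ?_⟩
  · rcases hσ with rfl | rfl <;> rcases hτ with rfl | rfl <;> norm_num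
  · rw [← hξ, norm_def]; ring
  · rw [hαξ, map_mul, map_pow, real_apply, real_apply]
    push_cast
    rfl
  · rw [hnX, hMdef, hZ.neg_pow]
  · rw [← hreal]; exact hbounds.2

/-! ### Conclusion. -/

theorem theorem1p3 (k : ℕ) (hk : 1 < k) (hsq : ¬ IsSquare k)
    (x y z : ℕ) (hx : 0 < x) (hy : 0 < y) (hz : 0 < z)
    (hxyz : (x : ℤ) ^ 2 + (2 * (k : ℤ) - 1) ^ y = (k : ℤ) ^ z)
    (hy35 : y = 3 ∨ y = 5) :
    Odd z ∧
    ∃ X₁ Y₁ Z₁ t : ℕ, ∃ l u v u₁ v₁ : ℤ,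
      0 < X₁ ∧ 0 < Y₁ ∧ 0 < Z₁ ∧ 0 < t ∧
      y = Z₁ * t ∧
      (l = 1 ∨ l = -1) ∧
      u ^ 2 - k * v ^ 2 = 1 ∧
      (x : ℝ) + (k : ℝ) ^ ((z - 1) / 2) * Real.sqrt k =
        ((X₁ : ℝ) + l * Y₁ * Real.sqrt k) ^ t * ((u : ℝ) + v * Real.sqrt k) ∧
      (X₁ : ℤ) ^ 2 - k * (Y₁ : ℤ) ^ 2 = (-(2 * (k : ℤ) - 1)) ^ Z₁ ∧
      Nat.gcd X₁ Y₁ = 1 ∧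
      Z₁ ∣ BinaryForm.classNumber (4 * k) ∧
      IsLeastPellSolution k u₁ v₁ ∧
      1 < |((X₁ : ℝ) + Y₁ * Real.sqrt k) / ((X₁ : ℝ) - Y₁ * Real.sqrt k)| ∧
      |((X₁ : ℝ) + Y₁ * Real.sqrt k) / ((X₁ : ℝ) - Y₁ * Real.sqrt k)| <
        (u₁ : ℝ) + v₁ * Real.sqrt k := by
  have hodd := odd_exponent hk hy35 hxyz
  refine ⟨hodd, ?_⟩
  have hy' : Odd y := by rcases hy35 with rfl | rfl <;> decide
  have hyp : y.Prime := by rcases hy35 with rfl | rfl <;> norm_num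
  have : Zsqrtd.Nonsquare k := ⟨fun n hn => hsq ⟨n, hn⟩⟩
  set N : ℤ := -(2 * (k : ℤ) - 1) with hN
  have hN0 : N ≠ 0 := by omega
  set α : ℤ√(k : ℤ) := ⟨x, k ^ ((z - 1) / 2)⟩ with hαdef
  have hkz : (k : ℤ) * k ^ ((z - 1) / 2) * k ^ ((z - 1) / 2) = k ^ z := by
    obtain ⟨m, rfl⟩ := hodd
    rw [Nat.add_sub_cancel, Nat.mul_div_cancel_left m two_pos]
    ring
  have hαN : α.norm = N ^ y := by
    rw [norm_def, hN, hy'.neg_pow]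
    change (x : ℤ) * x - k * k ^ ((z - 1) / 2) * k ^ ((z - 1) / 2) = _
    rw [hkz]; linear_combination hxyz
  have hkN : IsCoprime (k : ℤ) N := ⟨2, 1, by rw [hN]; ring⟩
  have hN2 : IsCoprime N 2 := ⟨1, k, by rw [hN]; ring⟩
  have hx2 : (x : ℤ) ^ 2 = N ^ y + k ^ z := by rw [hN, hy'.neg_pow]; linear_combination hxyz
  have hNx : IsCoprime N x := by
    apply (IsCoprime.pow_right_iff (m := 2) two_pos).1
    obtain ⟨j, rfl⟩ : ∃ j, y = j + 1 := ⟨y - 1, by omega⟩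
    rw [hx2, pow_succ', add_comm]
    exact IsCoprime.add_mul_left_right_iff.2 hkN.symm.pow_right
  have hkx : IsCoprime (k : ℤ) x := by
    apply (IsCoprime.pow_right_iff (m := 2) two_pos).1
    obtain ⟨j, rfl⟩ : ∃ j, z = j + 1 := ⟨z - 1, by omega⟩
    rw [hx2, pow_succ' (k : ℤ)]
    exact IsCoprime.add_mul_left_right_iff.2 hkN.pow_right
  have hco : IsCoprime α.re α.im := hkx.symm.pow_right
  have hco2 : IsCoprime N (2 * α.re) := hN2.mul_right hNx
  have hL := BinaryForm.span_pair_mul_conjIdeal (M := N ^ (y - 1))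
    (by rw [hαN, mul_comm, pow_sub_one_mul hy.ne']) hco2
  have hLy := BinaryForm.span_pair_pow hy.ne' hN0 hαN hco2
  have hreal : real k α = (x : ℝ) + (k : ℝ) ^ ((z - 1) / 2) * √(k : ℝ) := by
    rw [real_apply, hαdef]; push_cast; rfl
  rw [← hreal]
  rcases BinaryForm.exists_generator_or_dvd_classNumber hsq hN0 hL hyp hLy hαN with
    ⟨δ, hδ, hLδ⟩ | hdvd
  · rw [hLδ, Ideal.span_singleton_pow, Ideal.span_singleton_eq_span_singleton] at hLy
    obtain ⟨η, hη⟩ := hLy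
    -- The norm is `1` and not `-1` because `δ` has norm exactly `N`, sign included.
    have hη1 : (η : ℤ√(k : ℤ)).norm = 1 := by
      have h := congrArg Zsqrtd.norm hη
      rw [Zsqrtd.norm_mul, Zsqrtd.norm_pow, hδ, hαN] at h
      exact mul_left_cancel₀ (pow_ne_zero y hN0) (by rw [h, mul_one])
    obtain ⟨X, Y, l, u, v, u₁, v₁, h1, h2, h3, h4, h5, h6, h7, h8, h9, h10⟩ :=
      exists_reduced_solution hk hsq odd_one (by rw [hδ, pow_one]) hη1 hη.symm hy.ne' hco
    exact ⟨X, Y, 1, y, l, u, v, u₁, v₁, h1, h2, one_pos, hy, (one_mul y).symm, h3, h4, h5, h6, h7,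
      one_dvd _, h8, h9, h10⟩
  · obtain ⟨X, Y, l, u, v, u₁, v₁, h1, h2, h3, h4, h5, h6, h7, h8, h9, h10⟩ :=
      exists_reduced_solution hk hsq hy' hαN Zsqrtd.norm_one
        (by rw [pow_one, mul_one]) one_ne_zero hco
    exact ⟨X, Y, y, 1, l, u, v, u₁, v₁, h1, h2, hy, one_pos, (mul_one y).symm, h3, h4, h5, h6, h7,
      hdvd, h8, h9, h10⟩
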